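/- For an integer $k\ge 1$ let $(U_n(k))_{n\ge 0}$ be given by $U_0(k)=0$, $U_1(k)=1$, $U_{n+2}(k)=(4k+2)U_{n+1}(k)-U_n(k)$. For $n\ge 1$ let $\mathcal D_k(n)$ be the smallest positive integer $m$ such that $U_0(k),\ldots,U_{n-1}(k)$ are pairwise incongruent modulo $m$, and put $\mathcal D_k=\{\mathcal D_k(n): n\ge 1\}$. Let $\mathcal A_k$ be the set of odd positive integers $m$ all of whose prime factors divide $k$, and which moreover satisfy $9\nmid m$ if $k\equiv 6\pmod 9$. Let $\mathcal B_k$ be the set of even positive integers $m$ all of whose prime factors divide $k(k+1)$, and which moreover satisfy $9\nmid m$ if $k\equiv 2$ or $k\equiv 6\pmod 9$. Define the exceptional set $\mathcal F_k=\mathcal D_k\setminus(\mathcal A_k\cup\mathcal B_k)$. There are infinitely many integers $k>1$ for which $\mathcal F_k$ is finite and non-empty. Moreover, its cardinality can exceed any given bound: for every integer $B\ge 0$ there is an integer $k>1$ such that $\mathcal F_k$ is finite and $|\mathcal F_k|>B$. -/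

import Mathlib

namespace LucasDiscriminator

/-- The Lucas sequence `U_n(k)`: `U_0 = 0`, `U_1 = 1`, `U_{n+2} = (4k+2) U_{n+1} - U_n`. -/
def lucasU (k : ℕ) : ℕ → ℤ
  | 0 => 0
  | 1 => 1
  | n + 2 => (4 * (k : ℤ) + 2) * lucasU k (n + 1) - lucasU k n

/-- The modulus `m` discriminates `a_0, …, a_{n-1}`: these integers are pairwise
incongruent modulo `m`. -/
def Discriminates (a : ℕ → ℤ) (n m : ℕ) : Prop :=
  ∀ i < n, ∀ j < n, i ≠ j → ¬ a i ≡ a j [ZMOD (m : ℤ)]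

/-- `m` is the value at `n` of the discriminator of `a`: the smallest positive integer
discriminating the first `n` terms. -/
def IsDiscriminatorAt (a : ℕ → ℤ) (n m : ℕ) : Prop :=
  IsLeast {m' : ℕ | 0 < m' ∧ Discriminates a n m'} m

/-- The set `𝒟_k` of values, over all `n ≥ 1`, of the discriminator of `U(k)`. -/
def valueSet (k : ℕ) : Set ℕ :=
  {m | ∃ n : ℕ, 1 ≤ n ∧ IsDiscriminatorAt (lucasU k) n m}

/-- The set `𝒜_k`: odd `m` all of whose prime factors divide `k`, with `9 ∤ m` required
if `k ≡ 6 (mod 9)`. -/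
def setA (k : ℕ) : Set ℕ :=
  {m | Odd m ∧ (∀ p : ℕ, p.Prime → p ∣ m → p ∣ k) ∧ (k % 9 = 6 → ¬ 9 ∣ m)}

/-- The set `ℬ_k`: positive even `m` all of whose prime factors divide `k (k + 1)`, with `9 ∤ m`
required if `k ≡ 2` or `k ≡ 6 (mod 9)`. -/
def setB (k : ℕ) : Set ℕ :=
  {m | 0 < m ∧ Even m ∧ (∀ p : ℕ, p.Prime → p ∣ m → p ∣ k * (k + 1)) ∧
    (k % 9 = 2 ∨ k % 9 = 6 → ¬ 9 ∣ m)}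

/-- The exceptional set `ℱ_k`: the discriminator values outside `𝒜_k ∪ ℬ_k`. -/
def setF (k : ℕ) : Set ℕ :=
  valueSet k \ (setA k ∪ setB k)

end LucasDiscriminator

namespace LucasDiscriminator

/-! Take `k = 2 ^ u - 1` with `k ≡ 1 (mod 75)` and no odd prime factor up to a large bound.
Finiteness: the moduli `2 ^ c * k ^ b` with `c ≥ 1` discriminate as many terms as their size, and
for large `n` one lies in `[n, 3n/2)`. A modulus outside `𝒜_k ∪ ℬ_k` has an odd prime factor `p ∤ k
(k + 1)`. Such a `p` divides some `U_z` with `0 < z ≤ (p + 1)/2`, so the modulus `m` handles at most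
`2m/3` terms and loses for large `n`. Many exceptions: `2 ^ c * 5 ^ (b + 1)` discriminates three
fifths of its size. For infinitely many `j` such a modulus puts the discriminator at `128 ^ j + 1`
strictly between `128 ^ j` and `2 * 128 ^ j`. Elements of `𝒜_k ∪ ℬ_k` that small are powers of two,
and none lies there. Fixing many `j` before choosing `k` makes `|ℱ_k|` as large as desired. -/

/-- The companion sequence `V_n = α ^ n + α⁻¹ ^ n` of `U_n`. -/
def lucasV (k n : ℕ) : ℤ := 2 * lucasU k (n + 1) - (4 * (k : ℤ) + 2) * lucasU k n

/-! ### Identities for `U` and `V` -/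

section Identities

variable (k : ℕ)

theorem lucasU_zero : lucasU k 0 = 0 := rfl

theorem lucasU_one : lucasU k 1 = 1 := rfl

theorem lucasU_add_two (n : ℕ) :
    lucasU k (n + 2) = (4 * (k : ℤ) + 2) * lucasU k (n + 1) - lucasU k n := rfl

theorem lucasU_add_add_one (a b : ℕ) :
    lucasU k (a + b + 1) = lucasU k (a + 1) * lucasU k (b + 1) - lucasU k a * lucasU k b := by
  induction b using Nat.twoStepInduction with
  | zero => simp [lucasU_zero, lucasU_one]
  | one =>
    have h := lucasU_add_two k a
    have h1 := lucasU_add_two k 0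
    simp only [lucasU_zero, lucasU_one, zero_add] at h1 ⊢
    rw [h, h1]; ring
  | more b h1 h2 =>
    have e1 := lucasU_add_two k (a + b + 1)
    have e2 := lucasU_add_two k (b + 1)
    have e3 := lucasU_add_two k b
    rw [show a + (b + 2) + 1 = a + b + 1 + 2 by ring, e1,
      show a + b + 1 + 1 = a + (b + 1) + 1 by ring, h1, h2,
      show b + 2 + 1 = b + 1 + 2 by ring, e2, e3]
    ring

theorem lucasU_add (a b : ℕ) :
    lucasU k (a + b) = lucasU k a * lucasU k (b + 1) + lucasU k (a + 1) * lucasU k b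
      - (4 * (k : ℤ) + 2) * lucasU k a * lucasU k b := by
  cases b with
  | zero => simp [lucasU_zero, lucasU_one]
  | succ b =>
    have := lucasU_add_add_one k a b
    rw [← add_assoc, this, lucasU_add_two]; ring

theorem lucasU_sq_add_sq (n : ℕ) :
    lucasU k (n + 1) ^ 2 - (4 * (k : ℤ) + 2) * lucasU k (n + 1) * lucasU k n
      + lucasU k n ^ 2 = 1 := by
  induction n with
  | zero => simp [lucasU_zero, lucasU_one]
  | succ n ih => rw [lucasU_add_two]; linear_combination ih

/-- This factorization turns a congruence between terms with indices of equal parity into a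
divisibility. -/
theorem lucasU_add_two_mul_sub (a d : ℕ) :
    lucasU k (a + 2 * d) - lucasU k a = lucasU k d * lucasV k (a + d) := by
  have h1 := lucasU_add k (a + d) d
  have h2 := lucasU_add k a d
  have h3 := lucasU_add_add_one k a d
  have h4 := lucasU_sq_add_sq k d
  rw [show a + 2 * d = a + d + d by ring, lucasV, h1, h3, h2]
  linear_combination lucasU k a * h4

theorem lucasV_sq (n : ℕ) :
    lucasV k n ^ 2 = 4 + 16 * k * (k + 1) * lucasU k n ^ 2 := by
  have h4 := lucasU_sq_add_sq k n
  rw [lucasV]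
  linear_combination 4 * h4

theorem lucasV_add_two_mul_sub (a d : ℕ) :
    lucasV k (a + 2 * d) - lucasV k a
      = 16 * k * (k + 1) * (lucasU k d * lucasU k (a + d)) := by
  have h1 := lucasU_add_two_mul_sub k a d
  have h2 := lucasU_add_two_mul_sub k (a + 1) d
  rw [show a + 1 + 2 * d = a + 2 * d + 1 by ring, show a + 1 + d = a + d + 1 by ring] at h2
  have h3 := lucasU_add_two k (a + d)
  rw [lucasV, lucasV]
  rw [lucasV] at h1 h2
  rw [h3] at h2
  linear_combination 2 * h2 - (4 * (k : ℤ) + 2) * h1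

theorem lucasV_zero : lucasV k 0 = 2 := by simp [lucasV, lucasU_zero, lucasU_one]

theorem lucasV_one : lucasV k 1 = 4 * k + 2 := by
  have := lucasU_add_two k 0
  simp only [zero_add, lucasU_one, lucasU_zero] at this
  rw [lucasV, lucasU_one, this]; ring

theorem lucasV_add_two (n : ℕ) :
    lucasV k (n + 2) = (4 * (k : ℤ) + 2) * lucasV k (n + 1) - lucasV k n := by
  simp only [lucasV, lucasU_add_two]; ring

/-- Telescope `U_{(2i+1)a} - U_{(2i-1)a} = U_a V_{2ia}`, where `V_{2ia} = 2 + 16k(k+1) U_{ia}²`. It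
drives the lifting of odd prime powers. -/
theorem lucasU_odd_mul (h a : ℕ) :
    lucasU k ((2 * h + 1) * a) = lucasU k a *
      (2 * h + 1 + 16 * k * (k + 1) * ∑ i ∈ Finset.range h, lucasU k ((i + 1) * a) ^ 2) := by
  induction h with
  | zero => simp
  | succ h ih =>
    have h1 := lucasU_add_two_mul_sub k ((2 * h + 1) * a) a
    have h2 := lucasV_add_two_mul_sub k 0 ((h + 1) * a)
    rw [lucasV_zero, zero_add, zero_add] at h2
    rw [show (2 * h + 1) * a + 2 * a = (2 * (h + 1) + 1) * a by ring,
      show (2 * h + 1) * a + a = 2 * ((h + 1) * a) by ring] at h1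
    rw [Finset.sum_range_succ]
    push_cast
    linear_combination h1 + ih + lucasU k a * h2

theorem lucasU_two_mul (a : ℕ) : lucasU k (2 * a) = lucasU k a * lucasV k a := by
  have := lucasU_add_two_mul_sub k 0 a
  simpa [lucasU_zero] using this

theorem lucasU_dvd_lucasU_mul (a t : ℕ) : lucasU k a ∣ lucasU k (t * a) := by
  induction t with
  | zero => simp [lucasU_zero]
  | succ t ih =>
    rw [add_mul, one_mul, lucasU_add]
    exact dvd_sub (dvd_add (ih.mul_right _) (Dvd.intro_left _ rfl)) (Dvd.intro_left _ rfl)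

theorem lucasU_dvd_lucasU {a b : ℕ} (h : a ∣ b) : lucasU k a ∣ lucasU k b := by
  obtain ⟨t, rfl⟩ := h
  rw [mul_comm]
  exact lucasU_dvd_lucasU_mul k a t

theorem lucasU_modEq (n : ℕ) : lucasU k n ≡ n [ZMOD k] := by
  induction n using Nat.twoStepInduction with
  | zero => simp [lucasU_zero]
  | one => simp [lucasU_one]
  | more n h1 h2 =>
    rw [lucasU_add_two]
    have h3 : (4 * (k : ℤ) + 2) ≡ 2 [ZMOD k] := by
      simp [Int.modEq_iff_dvd]
    have := (h3.mul h2).sub h1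
    refine this.trans ?_
    push_cast
    ring_nf
    rfl

theorem lucasU_modEq_two (n : ℕ) : lucasU k n ≡ n [ZMOD 2] := by
  induction n using Nat.twoStepInduction with
  | zero => simp [lucasU_zero]
  | one => simp [lucasU_one]
  | more n h1 h2 =>
    rw [lucasU_add_two]
    have h3 : (4 * (k : ℤ) + 2) ≡ 0 [ZMOD 2] := by
      rw [Int.modEq_zero_iff_dvd]; omega
    have := (h3.mul h2).sub h1
    refine this.trans ?_
    push_cast
    rw [Int.modEq_iff_dvd]; omega

theorem lucasV_modEq (n : ℕ) : lucasV k n ≡ 2 [ZMOD k] := by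
  have h3 : (4 * (k : ℤ) + 2) ≡ 2 [ZMOD k] := by
    simp [Int.modEq_iff_dvd]
  have := ((lucasU_modEq k (n + 1)).mul_left 2).sub (h3.mul (lucasU_modEq k n))
  refine this.trans ?_
  push_cast
  ring_nf
  rfl

theorem exists_odd_lucasV (n : ℕ) : ∃ w, Odd w ∧ lucasV k n = 2 * w := by
  refine ⟨lucasU k (n + 1) - (2 * k + 1) * lucasU k n, ?_, by rw [lucasV]; ring⟩
  have h1 := lucasU_modEq_two k n
  have h2 := lucasU_modEq_two k (n + 1)
  have h3 : ((2 * k + 1 : ℤ)) ≡ 1 [ZMOD 2] := by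
    rw [Int.modEq_iff_dvd]; omega
  have h4 := h2.sub (h3.mul h1)
  push_cast at h4
  rw [Int.odd_iff]
  rw [show ((n : ℤ) + 1 - 1 * n) = 1 by ring] at h4
  exact h4

theorem lucasV_eq_dickson {R : Type*} [CommRing R] (n : ℕ) :
    (lucasV k n : R) = (Polynomial.dickson 1 (1 : R) n).eval (4 * (k : R) + 2) := by
  induction n using Nat.twoStepInduction with
  | zero => rw [lucasV_zero, Polynomial.dickson_zero]; simp; norm_num
  | one => rw [lucasV_one, Polynomial.dickson_one]; simp
  | more n h1 h2 =>
    rw [lucasV_add_two, Polynomial.dickson_add_two]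
    simp [h1, h2]

end Identities

/-! ### Upper bounds for the rank of appearance -/

section Rank

variable {k : ℕ}

/-- A prime not dividing the discriminant divides `U_n` for `n = (p - 1) / 2` or
`n = (p + 1) / 2`. -/
theorem exists_prime_dvd_lucasU {p : ℕ} (hp : p.Prime) (h2 : p ≠ 2) (hk : ¬ p ∣ k * (k + 1)) :
    ∃ z, 0 < z ∧ 2 * z ≤ p + 1 ∧ (p : ℤ) ∣ lucasU k z := by
  have := Fact.mk hp
  obtain ⟨h, rfl⟩ := hp.odd_of_ne_two h2
  have h0 : 0 < h := by have := hp.two_le; omega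
  have e := lucasV_add_two_mul_sub k 1 h
  -- In characteristic `p` the `p`-th Dickson polynomial is `X ^ p`, so Fermat gives `V_p ≡ V_1`; by
  -- `e` the difference is `16k(k+1) U_h U_{h+1}`.
  have hV : ((lucasV k (1 + 2 * h) : ℤ) : ZMod (2 * h + 1)) = lucasV k 1 := by
    rw [lucasV_eq_dickson, lucasV_eq_dickson, add_comm 1, Polynomial.dickson_one_one_charP,
      Polynomial.dickson_one]
    simp only [Polynomial.eval_pow, Polynomial.eval_X]
    exact ZMod.pow_card _
  have hd : ((2 * h + 1 : ℕ) : ℤ) ∣ 16 * k * (k + 1) * (lucasU k h * lucasU k (1 + h)) := by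
    rw [← e, ← ZMod.intCast_zmod_eq_zero_iff_dvd]
    push_cast
    rw [hV, sub_self]
  have hpz : Prime ((2 * h + 1 : ℕ) : ℤ) := Nat.prime_iff_prime_int.mp hp
  rcases hpz.dvd_or_dvd hd with hd | hd
  · exfalso
    have hd' : (2 * h + 1) ∣ 2 ^ 4 * (k * (k + 1)) := by
      have : (16 * k * (k + 1) : ℤ) = ((2 ^ 4 * (k * (k + 1)) : ℕ) : ℤ) := by push_cast; ring
      rw [this] at hd
      exact_mod_cast hd
    rcases hp.dvd_mul.mp hd' with hd | hd
    · exact h2 ((Nat.prime_dvd_prime_iff_eq hp Nat.prime_two).mp (hp.dvd_of_dvd_pow hd))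
    · exact hk hd
  · rcases hpz.dvd_or_dvd hd with hd | hd
    · exact ⟨h, h0, by omega, hd⟩
    · exact ⟨1 + h, by omega, by omega, hd⟩

theorem prime_mul_dvd_lucasU_mul {p a : ℕ} (hp : p.Prime) (h : (p : ℤ) ∣ lucasU k a) :
    (p : ℤ) * lucasU k a ∣ lucasU k (p * a) := by
  rcases hp.eq_two_or_odd' with rfl | ho
  · obtain ⟨w, -, hw⟩ := exists_odd_lucasV k a
    rw [lucasU_two_mul, hw]
    exact ⟨w, by push_cast; ring⟩
  · obtain ⟨h', rfl⟩ := ho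
    rw [lucasU_odd_mul, mul_comm]
    refine mul_dvd_mul_left _ (dvd_add (by push_cast; rfl) (Dvd.dvd.mul_left ?_ _))
    refine Finset.dvd_sum fun i _ => ?_
    exact (h.trans (lucasU_dvd_lucasU_mul k a (i + 1))).trans (dvd_pow_self _ two_ne_zero)

theorem exists_le_prime_dvd_lucasU (hk : ∀ p : ℕ, p.Prime → p ∣ k + 1 → p = 2) {p : ℕ}
    (hp : p.Prime) : ∃ z, 0 < z ∧ z ≤ p ∧ (p : ℤ) ∣ lucasU k z := by
  by_cases h2 : p = 2
  · refine ⟨2, by norm_num, h2.ge, ?_⟩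
    rw [← Int.modEq_zero_iff_dvd, h2]
    exact (lucasU_modEq_two k 2).trans (by decide)
  by_cases h : p ∣ k * (k + 1)
  · rcases hp.dvd_mul.mp h with h | h
    · refine ⟨p, hp.pos, le_rfl, ?_⟩
      rw [← Int.modEq_zero_iff_dvd]
      have := (lucasU_modEq k p).of_dvd (Int.natCast_dvd_natCast.mpr h)
      exact this.trans (by simp [Int.modEq_iff_dvd])
    · exact absurd (hk p hp h) h2
  · obtain ⟨z, h0, h1, h3⟩ := exists_prime_dvd_lucasU hp h2 h
    exact ⟨z, h0, by have := hp.two_le; omega, h3⟩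

/-- Add one prime `p` of `r` at a time: if `p ∣ U_a`, passing to `U_{pa}` gains a factor `p`;
otherwise `p` is coprime to `m`, and the index `a` is multiplied by one at most `p` whose term `p`
divides. -/
theorem exists_mul_dvd_lucasU (hk : ∀ p : ℕ, p.Prime → p ∣ k + 1 → p = 2) {r : ℕ}
    (hr : r ≠ 0) {m a : ℕ} (ha : 0 < a) (h : (m : ℤ) ∣ lucasU k a) :
    ∃ z, 0 < z ∧ z ≤ r * a ∧ ((r * m : ℕ) : ℤ) ∣ lucasU k z := by
  induction r using Nat.recOnMul generalizing m a with
  | zero => exact absurd rfl hr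
  | one => exact ⟨a, ha, by simp, by simpa using h⟩
  | prime p hp =>
    by_cases hpa : (p : ℤ) ∣ lucasU k a
    · refine ⟨p * a, Nat.mul_pos hp.pos ha, le_rfl, ?_⟩
      push_cast
      exact (mul_dvd_mul_left _ h).trans (prime_mul_dvd_lucasU_mul hp hpa)
    · obtain ⟨c, hc, hcp, hdvd⟩ := exists_le_prime_dvd_lucasU hk hp
      refine ⟨c * a, Nat.mul_pos hc ha, Nat.mul_le_mul_right a hcp, ?_⟩
      have hcop : IsCoprime (p : ℤ) (m : ℤ) :=
        (Nat.prime_iff_prime_int.mp hp).irreducible.coprime_iff_not_dvd.mpr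
          fun h' => hpa (h'.trans h)
      push_cast
      exact hcop.mul_dvd (hdvd.trans (lucasU_dvd_lucasU k (Dvd.intro _ rfl)))
        (h.trans (lucasU_dvd_lucasU_mul k a c))
  | mul r s h1 h2 =>
    obtain ⟨hr0, hs0⟩ := mul_ne_zero_iff.mp hr
    obtain ⟨y, hy, hya, hyd⟩ := h2 hs0 ha h
    obtain ⟨z, hz, hzy, hzd⟩ := h1 hr0 hy hyd
    refine ⟨z, hz, ?_, by rwa [mul_assoc]⟩
    rw [mul_assoc]
    exact hzy.trans (Nat.mul_le_mul_left r hya)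

/-- A modulus with a prime factor not dividing `k (k + 1)` discriminates at most two thirds as
many terms as its size. -/
theorem Discriminates.three_mul_le (hk : ∀ p : ℕ, p.Prime → p ∣ k + 1 → p = 2) {n m p : ℕ}
    (hm : 0 < m) (hp : p.Prime) (h2 : p ≠ 2) (hpm : p ∣ m) (hpk : ¬ p ∣ k * (k + 1))
    (h : Discriminates (lucasU k) n m) : 3 * n ≤ 2 * m := by
  obtain ⟨r, rfl⟩ := hpm
  have hr : r ≠ 0 := by rintro rfl; simp at hm
  obtain ⟨a, ha, hap, had⟩ := exists_prime_dvd_lucasU hp h2 hpk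
  obtain ⟨z, hz, hza, hzd⟩ := exists_mul_dvd_lucasU hk hr ha had
  have hnz : n ≤ z := by
    by_contra! hlt
    refine h z hlt 0 (by omega) hz.ne' ?_
    rw [lucasU_zero, Int.modEq_zero_iff_dvd, mul_comm p r]
    exact hzd
  have hp3 : 3 ≤ p := by have := hp.two_le; omega
  -- `(p + 1)/2 ≤ 2p/3` exactly because `p ≥ 3`.
  have : 3 * a ≤ 2 * p := by omega
  nlinarith [Nat.mul_le_mul_left r this]

end Rank

/-! ### Two families of efficient moduli -/

section Discriminating

variable {k : ℕ}

/-- `U_{2t} = U_t V_t` with `V_t` twice an odd number, so doubling the index gains exactly one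
factor 2. -/
theorem two_pow_dvd_of_dvd_lucasU {c n : ℕ} (h : (2 : ℤ) ^ c ∣ lucasU k n) : 2 ^ c ∣ n := by
  induction c generalizing n with
  | zero => simp
  | succ c ih =>
    have h2 : (2 : ℤ) ∣ lucasU k n := (dvd_pow_self _ c.succ_ne_zero).trans h
    have hn : 2 ∣ n := by
      have := (lucasU_modEq_two k n).symm.trans (Int.modEq_zero_iff_dvd.mpr h2)
      exact_mod_cast Int.modEq_zero_iff_dvd.mp this
    obtain ⟨t, rfl⟩ := hn
    obtain ⟨w, hw, hV⟩ := exists_odd_lucasV k t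
    rw [lucasU_two_mul, hV, pow_succ', show lucasU k t * (2 * w) = 2 * (lucasU k t * w) by ring,
      mul_dvd_mul_iff_left two_ne_zero] at h
    have hcop : IsCoprime ((2 : ℤ) ^ c) w := (Int.isCoprime_two_left.mpr hw).pow_left
    rw [pow_succ']
    exact mul_dvd_mul_left 2 (ih (hcop.dvd_of_dvd_mul_right h))

/-- A collision forces equal parity, `j = i + 2d`, hence `2 ^ c * q ∣ U_d V_{i+d}`. As `V_{i+d}` is
twice odd, `2 ^ (c - 1) * T ∣ d`, so `j ≥ 2d ≥ 2 ^ c * T ≥ n`. -/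
theorem discriminates_of_dvd {c q T : ℕ} (hc : c ≠ 0) (hT : Odd T)
    (h : ∀ d s : ℕ, (q : ℤ) ∣ lucasU k d * lucasV k s → T ∣ d) {n : ℕ} (hn : n ≤ 2 ^ c * T) :
    Discriminates (lucasU k) n (2 ^ c * q) := by
  have key : ∀ i j : ℕ, i < j → j < n → ¬ lucasU k i ≡ lucasU k j [ZMOD ((2 ^ c * q : ℕ) : ℤ)] := by
    intro i j hij hj hmod
    have h2 : ((2 : ℤ) ^ c) ∣ ((2 ^ c * q : ℕ) : ℤ) := ⟨q, by push_cast; ring⟩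
    have hpar : (i : ℤ) ≡ j [ZMOD 2] :=
      ((lucasU_modEq_two k i).symm.trans
        (hmod.of_dvd ((dvd_pow_self _ hc).trans h2))).trans (lucasU_modEq_two k j)
    obtain ⟨d, rfl⟩ : ∃ d, j = i + 2 * d := ⟨(j - i) / 2, by
      have := hpar.dvd; omega⟩
    have hdvd := hmod.dvd
    rw [lucasU_add_two_mul_sub] at hdvd
    have hTd : T ∣ d := h d (i + d) ((Int.natCast_dvd_natCast.mpr (Dvd.intro_left _ rfl)).trans hdvd)
    obtain ⟨w, hw, hV⟩ := exists_odd_lucasV k (i + d)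
    obtain ⟨e, rfl⟩ := Nat.exists_eq_succ_of_ne_zero hc
    have h3 := h2.trans hdvd
    rw [hV, Nat.succ_eq_add_one, pow_succ',
      show lucasU k d * (2 * w) = 2 * (lucasU k d * w) by ring,
      mul_dvd_mul_iff_left two_ne_zero] at h3
    have hcop : IsCoprime ((2 : ℤ) ^ e) w := ((Int.isCoprime_two_left).mpr hw).pow_left
    have h4 := two_pow_dvd_of_dvd_lucasU (hcop.dvd_of_dvd_mul_right h3)
    have h5 : 2 ^ e * T ∣ d :=
      Nat.Coprime.mul_dvd_of_dvd_of_dvd (Nat.Coprime.pow_left e (Nat.coprime_two_left.mpr hT)) h4 hTd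
    have h6 := Nat.le_of_dvd (by omega) h5
    rw [Nat.succ_eq_add_one, pow_succ', mul_assoc] at hn
    omega
  intro i hi j hj hne hmod
  rcases lt_or_gt_of_ne hne with h' | h'
  · exact key i j h' hj hmod
  · exact key j i h' hi hmod.symm

theorem isCoprime_lucasV (hk : Odd k) (s : ℕ) : IsCoprime (k : ℤ) (lucasV k s) := by
  obtain ⟨t, ht⟩ := (lucasV_modEq k s).symm.dvd
  rw [show lucasV k s = 2 + k * t by linarith]
  exact IsCoprime.add_mul_left_right
    ((Int.isCoprime_two_right).mpr (by exact_mod_cast hk)) t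

/-- `U_{kt} = k U_t w` with `w ≡ 1 (mod k)`, so factors of `k` can be stripped one by one. -/
theorem pow_dvd_of_dvd_lucasU (hk : Nat.Coprime k 6) {b n : ℕ}
    (h : (k : ℤ) ^ b ∣ lucasU k n) : k ^ b ∣ n := by
  induction b generalizing n with
  | zero => simp
  | succ b ih =>
    have h1 : (k : ℤ) ∣ lucasU k n := (dvd_pow_self _ b.succ_ne_zero).trans h
    have hn : k ∣ n := by
      have := (lucasU_modEq k n).symm.trans (Int.modEq_zero_iff_dvd.mpr h1)
      exact_mod_cast Int.modEq_zero_iff_dvd.mp this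
    obtain ⟨t, rfl⟩ := hn
    have hk2 : Odd k := Nat.coprime_two_right.mp (hk.coprime_dvd_right (by norm_num))
    have hk0 : (k : ℤ) ≠ 0 := by
      have := hk2.pos; positivity
    obtain ⟨r, hr⟩ := hk2
    have hs : (k : ℤ) ∣ ∑ i ∈ Finset.range r, lucasU k ((i + 1) * t) ^ 2 := by
      have hmod : ∑ i ∈ Finset.range r, lucasU k ((i + 1) * t) ^ 2
          ≡ ∑ i ∈ Finset.range r, (((i + 1) * t : ℕ) : ℤ) ^ 2 [ZMOD k] :=
        Int.ModEq.sum fun i _ => (lucasU_modEq k _).pow 2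
      -- The sum of squares formula has the factor `2r + 1 = k`; coprimality to 6 removes the
      -- denominator.
      have hsum : 6 * ∑ i ∈ Finset.range r, (((i + 1) * t : ℕ) : ℤ) ^ 2
          = k * (r * (r + 1) * t ^ 2) := by
        rw [hr]
        clear hmod hr
        induction r with
        | zero => simp
        | succ r ih => rw [Finset.sum_range_succ, mul_add, ih]; push_cast; ring
      have hcop : IsCoprime (k : ℤ) 6 := by exact_mod_cast (Nat.isCoprime_iff_coprime.mpr hk)
      have hd := hcop.dvd_of_dvd_mul_left (Dvd.intro _ hsum.symm)
      exact (Int.ModEq.dvd_iff hmod).mpr hd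
    obtain ⟨y, hy⟩ := hs
    have e := lucasU_odd_mul k r t
    rw [← hr, hy] at e
    have e' : lucasU k (k * t) = k * (lucasU k t * (1 + k * (16 * (k + 1) * y))) := by
      rw [e]
      have : (2 * r + 1 : ℤ) = k := by exact_mod_cast hr.symm
      rw [this]; ring
    rw [e', pow_succ', mul_dvd_mul_iff_left hk0] at h
    have hcop : IsCoprime ((k : ℤ) ^ b) (1 + k * (16 * (k + 1) * y)) :=
      (IsCoprime.add_mul_left_right isCoprime_one_right _).pow_left
    rw [pow_succ']
    exact mul_dvd_mul_left k (ih (hcop.dvd_of_dvd_mul_right h))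

/-- The moduli `2 ^ c * k ^ b` discriminate as many terms as their size. -/
theorem discriminates_two_pow_mul_pow (hk : Nat.Coprime k 6) {c b n : ℕ} (hc : c ≠ 0)
    (hn : n ≤ 2 ^ c * k ^ b) : Discriminates (lucasU k) n (2 ^ c * k ^ b) := by
  have hk2 : Odd k := Nat.coprime_two_right.mp (hk.coprime_dvd_right (by norm_num))
  refine discriminates_of_dvd hc hk2.pow (fun d s h => pow_dvd_of_dvd_lucasU hk ?_) hn
  push_cast at h
  exact ((isCoprime_lucasV hk2 s).pow_left).dvd_of_dvd_mul_right h

/-- Modulo 5, `V² = 4 + 2U²`, which vanishes only if `U² = 3`, a nonresidue. -/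
theorem isCoprime_five_lucasV (hk : k ≡ 1 [MOD 5]) (s : ℕ) : IsCoprime (5 : ℤ) (lucasV k s) := by
  refine (Nat.prime_iff_prime_int.mp Nat.prime_five).irreducible.coprime_iff_not_dvd.mpr fun h => ?_
  have e := congrArg (Int.cast : ℤ → ZMod 5) (lucasV_sq k s)
  have h0 : (lucasV k s : ZMod 5) = 0 := (ZMod.intCast_zmod_eq_zero_iff_dvd _ 5).mpr h
  have hk' : (k : ZMod 5) = 1 := by
    have := (ZMod.natCast_eq_natCast_iff _ _ _).mpr hk
    simpa using this
  push_cast at e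
  rw [h0, hk'] at e
  generalize (lucasU k s : ZMod 5) = x at e
  revert x
  decide

theorem lucasU_three : lucasU k 3 = (4 * k + 2) ^ 2 - 1 := by
  simp only [lucasU]; ring

theorem three_dvd_of_five_dvd_lucasU (hk : k ≡ 1 [MOD 5]) {n : ℕ}
    (h : (5 : ℤ) ∣ lucasU k n) : 3 ∣ n := by
  have hk' : (k : ZMod 5) = 1 := by
    have := (ZMod.natCast_eq_natCast_iff _ _ _).mpr hk
    simpa using this
  have h0 : (lucasU k n : ZMod 5) = 0 := (ZMod.intCast_zmod_eq_zero_iff_dvd _ 5).mpr h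
  clear h
  induction n using Nat.strong_induction_on with
  | _ n ih =>
    match n with
    | 0 => simp
    | 1 => revert h0; simp only [lucasU]; decide
    | 2 => revert h0; simp [lucasU, hk']; decide
    | n + 3 =>
      have := ih n (by omega) (by
        rw [lucasU_add] at h0
        simp [lucasU, hk'] at h0
        generalize (lucasU k n : ZMod 5) = x at h0 ⊢
        generalize (lucasU k (n + 1) : ZMod 5) = y at h0
        revert x y; decide)
      omega

/-- Modulo 25 the sequence is that of `k = 1`, with `U_15 = 0` and `U_16 = -1`, so `U_{t+15} =
-U_t`; the indices below 15 are checked directly. -/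
theorem fifteen_dvd_of_dvd_lucasU (hk : k ≡ 1 [MOD 25]) {n : ℕ}
    (h : (25 : ℤ) ∣ lucasU k n) : 15 ∣ n := by
  have hk' : (k : ZMod 25) = 1 := by
    have := (ZMod.natCast_eq_natCast_iff _ _ _).mpr hk
    simpa using this
  have h0 : (lucasU k n : ZMod 25) = 0 := (ZMod.intCast_zmod_eq_zero_iff_dvd _ 25).mpr h
  clear h
  have hU : ∀ j, (lucasU k j : ZMod 25) = lucasU 1 j := by
    intro j
    induction j using Nat.twoStepInduction with
    | zero => rfl
    | one => rfl
    | more j h1 h2 => rw [lucasU_add_two, lucasU_add_two]; push_cast; rw [h1, h2, hk']; norm_num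
  rw [hU] at h0
  induction n using Nat.strong_induction_on with
  | _ n ih =>
    by_cases hn : n < 15
    · revert h0
      interval_cases n <;> simp [lucasU] <;> decide
    · obtain ⟨t, rfl⟩ := Nat.exists_eq_add_of_le' (not_lt.mp hn)
      have := ih t (by omega) (by
        rw [lucasU_add] at h0
        have e1 : (lucasU 1 15 : ZMod 25) = 0 := by simp [lucasU]; decide
        have e2 : (lucasU 1 (15 + 1) : ZMod 25) = -1 := by simp [lucasU]; decide
        push_cast at h0
        rw [e1, e2] at h0
        simpa using h0)
      omega

theorem five_pow_dvd_of_dvd_lucasU (hk : k ≡ 1 [MOD 25]) {b n : ℕ}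
    (h : (5 : ℤ) ^ (b + 1) ∣ lucasU k n) : 3 * 5 ^ b ∣ n := by
  have hk5 : k ≡ 1 [MOD 5] := hk.of_dvd (by norm_num)
  induction b generalizing n with
  | zero => simpa using three_dvd_of_five_dvd_lucasU hk5 (by simpa using h)
  | succ b ih =>
    have h25 : (25 : ℤ) ∣ lucasU k n :=
      (by rw [show (25 : ℤ) = 5 ^ 2 by norm_num]; exact pow_dvd_pow 5 (by omega) :
        (25 : ℤ) ∣ 5 ^ (b + 1 + 1)).trans h
    obtain ⟨t, rfl⟩ : 5 ∣ n := (by norm_num : 5 ∣ 15).trans (fifteen_dvd_of_dvd_lucasU hk h25)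
    have h3 : 3 ∣ t := by have := fifteen_dvd_of_dvd_lucasU hk h25; omega
    have h5 : (5 : ℤ) ∣ lucasU k t := by
      refine dvd_trans ?_ (lucasU_dvd_lucasU k h3)
      rw [lucasU_three]
      have : (k : ℤ) ≡ 1 [ZMOD 5] := by exact_mod_cast (Int.natCast_modEq_iff.mpr hk5)
      have := ((((this.mul_left 4).add_right 2).pow 2).sub_right 1)
      exact Int.modEq_zero_iff_dvd.mp (this.trans (by decide))
    have hs : (5 : ℤ) ∣ ∑ i ∈ Finset.range 2, lucasU k ((i + 1) * t) ^ 2 :=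
      Finset.dvd_sum fun i _ =>
        (h5.trans (lucasU_dvd_lucasU_mul k t (i + 1))).trans (dvd_pow_self _ two_ne_zero)
    obtain ⟨y, hy⟩ := hs
    have e := lucasU_odd_mul k 2 t
    rw [hy] at e
    -- Since `5 ∤ k (k + 1)`, the sum must be divisible by 25 for the cofactor, once 5 is taken out,
    -- to be `1` modulo 5.
    have hsq : ∃ z, y = 5 * z := by
      have : (5 : ℤ) ^ 2 ∣ ∑ i ∈ Finset.range 2, lucasU k ((i + 1) * t) ^ 2 :=
        Finset.dvd_sum fun i _ => pow_dvd_pow_of_dvd (h5.trans (lucasU_dvd_lucasU_mul k t (i + 1))) 2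
      rw [hy, sq] at this
      exact (mul_dvd_mul_iff_left (by norm_num)).mp this
    obtain ⟨z, rfl⟩ := hsq
    have e' : lucasU k (5 * t) = 5 * (lucasU k t * (1 + 5 * (16 * k * (k + 1) * z))) := by
      rw [show 5 * t = (2 * 2 + 1) * t by ring, e]; push_cast; ring
    rw [e', pow_succ', mul_dvd_mul_iff_left (by norm_num)] at h
    have hcop : IsCoprime ((5 : ℤ) ^ (b + 1)) (1 + 5 * (16 * k * (k + 1) * z)) :=
      (IsCoprime.add_mul_left_right isCoprime_one_right _).pow_left
    rw [pow_succ', ← mul_assoc, mul_comm 3, mul_assoc]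
    exact mul_dvd_mul_left 5 (ih (hcop.dvd_of_dvd_mul_right h))

/-- The moduli `2 ^ c * 5 ^ (b + 1)` discriminate three fifths as many terms as their size. -/
theorem discriminates_two_pow_mul_five_pow (hk : k ≡ 1 [MOD 25]) {c b n : ℕ} (hc : c ≠ 0)
    (hn : n ≤ 2 ^ c * (3 * 5 ^ b)) :
    Discriminates (lucasU k) n (2 ^ c * 5 ^ (b + 1)) := by
  refine discriminates_of_dvd hc ?_ (fun d s h => five_pow_dvd_of_dvd_lucasU hk ?_) hn
  · exact Odd.mul (by decide) (Odd.pow (by decide))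
  · push_cast at h
    exact ((isCoprime_five_lucasV (hk.of_dvd (by norm_num)) s).pow_left).dvd_of_dvd_mul_right h

end Discriminating

/-! ### General facts and a Bernoulli inequality -/

theorem Discriminates.mono {a : ℕ → ℤ} {n n' m : ℕ} (h : Discriminates a n m) (hn : n' ≤ n) :
    Discriminates a n' m :=
  fun i hi j hj => h i (hi.trans_le hn) j (hj.trans_le hn)

theorem Discriminates.le {a : ℕ → ℤ} {n m : ℕ} (hm : 0 < m) (h : Discriminates a n m) :
    n ≤ m := by
  by_contra! hlt
  have : NeZero m := ⟨hm.ne'⟩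
  obtain ⟨i, hi, j, hj, hne, hij⟩ := Finset.exists_ne_map_eq_of_card_lt_of_maps_to
    (s := Finset.range n) (t := (Finset.univ : Finset (ZMod m))) (f := fun i => (a i : ZMod m))
    (by simpa [ZMod.card] using hlt) (fun _ _ => Finset.mem_coe.mpr (Finset.mem_univ _))
  exact h i (Finset.mem_range.mp hi) j (Finset.mem_range.mp hj) hne
    ((ZMod.intCast_eq_intCast_iff _ _ _).mp hij)

theorem add_mul_pow_le (k j : ℕ) : (k + j) * k ^ j ≤ k * (k + 1) ^ j := by
  induction j with
  | zero => simp
  | succ j ih =>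
    calc (k + (j + 1)) * k ^ (j + 1) = (k * (k + j + 1)) * k ^ j := by ring
      _ ≤ ((k + j) * (k + 1)) * k ^ j := Nat.mul_le_mul_right _ (by nlinarith)
      _ = ((k + j) * k ^ j) * (k + 1) := by ring
      _ ≤ (k * (k + 1) ^ j) * (k + 1) := Nat.mul_le_mul_right _ ih
      _ = k * (k + 1) ^ (j + 1) := by ring

/-! ### Finiteness and exceptional values for `k = 2 ^ u - 1` -/

section Mersenne

variable {k u : ℕ}

/-- For `k = 2 ^ u - 1`, every interval `[n, 3 n / 2)` with `n` large contains an even number of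
the form `2 ^ c * k ^ b`. -/
theorem exists_two_pow_mul_pow_mem (hk : 3 ≤ k) (hu : k + 1 = 2 ^ u) :
    ∃ N, 0 < N ∧ ∀ n, N ≤ n → ∃ c b, c ≠ 0 ∧ n ≤ 2 ^ c * k ^ b ∧ 2 * (2 ^ c * k ^ b) < 3 * n := by
  -- This bound makes `e > u * k` below, so a factor 2 survives up to `k` replacements of `2 ^ u` by
  -- `k`.
  refine ⟨2 ^ (u * k), by positivity, fun n hn => ?_⟩
  have hn0 : 0 < n := lt_of_lt_of_le (by positivity) hn
  obtain ⟨e, he1, he2⟩ := exists_nat_pow_near (x := 3 * n - 1) (y := 2) (by omega) (by norm_num)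
  rw [pow_succ] at he2
  have hue : u * k < e := by
    refine (Nat.pow_lt_pow_iff_right (a := 2) (by norm_num)).mp ?_
    omega
  have hwit : 2 * 2 ^ e * k ^ k < 3 * n * (k + 1) ^ k := by
    have h1 : 2 * k ^ k ≤ (k + 1) ^ k := by
      have := add_mul_pow_le k k
      exact le_of_mul_le_mul_left (a := k) (by linarith) (by omega)
    calc 2 * 2 ^ e * k ^ k < (6 * n) * k ^ k :=
          Nat.mul_lt_mul_of_pos_right (by omega) (by positivity)
      _ = 3 * n * (2 * k ^ k) := by ring
      _ ≤ 3 * n * (k + 1) ^ k := Nat.mul_le_mul_left _ h1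
  classical
  -- Start from `2 ^ e` in `[3n/2, 3n)` and multiply by `k/(k + 1)` until first below `3n/2`;
  -- Bernoulli bounds the number of steps by `k`. The last factor is at least `3/4`, so the result
  -- is at least `9n/8`.
  obtain ⟨b, hb, hbk, hmin⟩ : ∃ b, 2 * 2 ^ e * k ^ b < 3 * n * (k + 1) ^ b ∧ b ≤ k ∧
      ∀ b' < b, 3 * n * (k + 1) ^ b' ≤ 2 * 2 ^ e * k ^ b' :=
    have hex : ∃ b, 2 * 2 ^ e * k ^ b < 3 * n * (k + 1) ^ b := ⟨k, hwit⟩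
    ⟨Nat.find hex, Nat.find_spec hex, Nat.find_min' hex hwit,
      fun b' h => not_lt.mp (Nat.find_min hex h)⟩
  obtain _ | b := b
  · simp at hb; omega
  have hm := hmin b (Nat.lt_succ_self b)
  have hub : u * (b + 1) < e := lt_of_le_of_lt (Nat.mul_le_mul_left u hbk) hue
  obtain ⟨c, rfl⟩ := Nat.exists_eq_add_of_lt hub
  have hpow : 2 ^ (u * (b + 1) + c + 1) = 2 ^ (c + 1) * ((k + 1) ^ b * (k + 1)) := by
    rw [hu, ← pow_mul, ← pow_add, ← pow_add]; ring_nf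
  rw [hpow] at hb hm
  have hK : 0 < (k + 1) ^ b := by positivity
  refine ⟨c + 1, b + 1, by omega, ?_, ?_⟩
  · have h1 : 3 * n ≤ 2 * 2 ^ (c + 1) * (k + 1) * k ^ b := by
      refine le_of_mul_le_mul_right (a := (k + 1) ^ b) ?_ hK
      linarith
    have h2 : 3 * (k + 1) * (2 ^ (c + 1) * k ^ b) ≤ 4 * k * (2 ^ (c + 1) * k ^ b) :=
      Nat.mul_le_mul_right _ (by omega)
    rw [pow_succ k]
    linarith
  · refine Nat.lt_of_mul_lt_mul_right (a := (k + 1) ^ b * (k + 1)) ?_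
    rw [pow_succ (k + 1)] at hb
    linarith

theorem eq_two_of_prime_dvd_succ (hu : k + 1 = 2 ^ u) (p : ℕ) (hp : p.Prime) (h : p ∣ k + 1) :
    p = 2 := by
  rw [hu] at h
  exact (Nat.prime_dvd_prime_iff_eq hp Nat.prime_two).mp (hp.dvd_of_dvd_pow h)

theorem exists_prime_of_notMem (hk3 : k % 3 = 1) (hu : k + 1 = 2 ^ u) (hu0 : u ≠ 0) {m : ℕ}
    (hm : 0 < m) (h : m ∉ setA k ∪ setB k) :
    ∃ p : ℕ, p.Prime ∧ p ≠ 2 ∧ p ∣ m ∧ ¬ p ∣ k * (k + 1) := by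
  by_contra! hall
  refine h ?_
  have h2 : 2 ∣ k + 1 := hu ▸ dvd_pow_self 2 hu0
  rcases Nat.even_or_odd m with he | ho
  -- `k ≡ 1 (mod 3)` excludes the residues 2 and 6 modulo 9, so the conditions on 9 are void.
  · refine Or.inr ⟨hm, he, fun p hp hpm => ?_, fun h9 => by omega⟩
    by_cases hp2 : p = 2
    · rw [hp2]; exact h2.mul_left k
    · exact hall p hp hp2 hpm
  · refine Or.inl ⟨ho, fun p hp hpm => ?_, fun h9 => by omega⟩
    have hp2 : p ≠ 2 := by
      rintro rfl
      exact (Nat.not_even_iff_odd.mpr ho) (even_iff_two_dvd.mpr hpm)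
    exact (hp.dvd_mul.mp (hall p hp hp2 hpm)).resolve_right
      fun h => hp2 (eq_two_of_prime_dvd_succ hu p hp h)

theorem setF_finite (hk : 3 ≤ k) (hk3 : k % 3 = 1) (hu : k + 1 = 2 ^ u) :
    (setF k).Finite := by
  have hu0 : u ≠ 0 := by rintro rfl; simp at hu; omega
  have h2 : 2 ∣ k + 1 := hu ▸ dvd_pow_self 2 hu0
  have hcop : Nat.Coprime k 6 := by
    rw [show 6 = 2 * 3 by norm_num, Nat.coprime_mul_iff_right]
    refine ⟨Nat.coprime_two_right.mpr (by rw [Nat.odd_iff]; omega), ?_⟩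
    exact ((Nat.Prime.coprime_iff_not_dvd Nat.prime_three).mpr (by omega)).symm
  obtain ⟨N, hN, hmem⟩ := exists_two_pow_mul_pow_mem hk hu
  obtain ⟨c, b, hc, hle, -⟩ := hmem N le_rfl
  refine (Set.finite_Iic (2 ^ c * k ^ b)).subset ?_
  rintro m ⟨⟨n, hn, ⟨hm, hdisc⟩, hleast⟩, hnot⟩
  rcases le_total n N with hnN | hNn
  · exact hleast ⟨by positivity,
      (discriminates_two_pow_mul_pow hcop hc hle).mono hnN⟩
  · exfalso
    obtain ⟨c', b', hc', hle', hlt'⟩ := hmem n hNn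
    have hmle : m ≤ 2 ^ c' * k ^ b' :=
      hleast ⟨by positivity, discriminates_two_pow_mul_pow hcop hc' hle'⟩
    obtain ⟨p, hp, hp2, hpm, hpk⟩ := exists_prime_of_notMem hk3 hu hu0 hm hnot
    have := hdisc.three_mul_le (eq_two_of_prime_dvd_succ hu) hm hp hp2 hpm hpk
    omega

/-- A number of the form `2 ^ (s + 1) * 125 ^ j` slightly below `2 * 128 ^ j` forces a value of
the discriminator strictly between the two consecutive powers of two `128 ^ j`, `2 * 128 ^ j`. -/
theorem exists_mem_setF (hk : k ≡ 1 [MOD 25]) (hu : k + 1 = 2 ^ u) {j s : ℕ} (hj : j ≠ 0)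
    (h1 : 2 ^ s * 125 ^ j < 128 ^ j) (h2 : 125 * 128 ^ j ≤ 128 * (2 ^ s * 125 ^ j))
    (hp : ∀ p : ℕ, p.Prime → p ≠ 2 → p ≤ 2 * 128 ^ j → ¬ p ∣ k) :
    ∃ m ∈ setF k, 128 ^ j < m ∧ m < 2 * 128 ^ j := by
  have h128 : 128 ≤ 128 ^ j := Nat.le_self_pow hj 128
  obtain ⟨i, rfl⟩ := Nat.exists_eq_succ_of_ne_zero hj
  have e5 : 125 ^ (i + 1) = 5 ^ (3 * i + 2 + 1) := by
    rw [show 125 = 5 ^ 3 by norm_num, ← pow_mul]; ring_nf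
  have hdisc : Discriminates (lucasU k) (128 ^ (i + 1) + 1) (2 ^ (s + 1) * 125 ^ (i + 1)) := by
    rw [e5]
    refine discriminates_two_pow_mul_five_pow hk s.succ_ne_zero ?_
    rw [Nat.succ_eq_add_one] at h2 h128
    rw [e5, pow_succ 5] at h2
    -- The modulus covers `(6/5) * 2 ^ s * 125 ^ j ≥ (150/128) * 128 ^ j` terms, enough for `128 ^ j
    -- + 1`.
    rw [pow_succ 2, show 2 ^ s * 2 * (3 * 5 ^ (3 * i + 2)) = 6 * (2 ^ s * 5 ^ (3 * i + 2)) by ring]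
    rw [← mul_assoc (2 ^ s)] at h2
    omega
  have hex : ∃ m, 0 < m ∧ Discriminates (lucasU k) (128 ^ (i + 1) + 1) m :=
    ⟨_, by positivity, hdisc⟩
  classical
  obtain ⟨m, ⟨hm, hmd⟩, hleast⟩ : ∃ m, IsDiscriminatorAt (lucasU k) (128 ^ (i + 1) + 1) m :=
    ⟨Nat.find hex, Nat.find_spec hex, fun m' h => Nat.find_min' hex h⟩
  have hlt : 128 ^ (i + 1) < m := hmd.le hm
  have hgt : m < 2 * 128 ^ (i + 1) := by
    have := hleast ⟨by positivity, hdisc⟩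
    rw [pow_succ 2, mul_comm (2 ^ s), mul_assoc] at this
    rw [Nat.succ_eq_add_one] at h1
    omega
  refine ⟨m, ⟨⟨_, by omega, ⟨hm, hmd⟩, hleast⟩, ?_⟩, hlt, hgt⟩
  rintro (⟨ho, hA, -⟩ | ⟨-, he, hB, -⟩)
  · obtain ⟨p, hpp, hpm⟩ := Nat.exists_prime_and_dvd (n := m) (by omega)
    refine hp p hpp ?_ ((Nat.le_of_dvd hm hpm).trans hgt.le) (hA p hpp hpm)
    rintro rfl
    exact (Nat.not_even_iff_odd.mpr ho) (even_iff_two_dvd.mpr hpm)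
  · have hpow := Nat.eq_prime_pow_of_unique_prime_dvd (n := m) (p := 2) hm.ne' (by
      intro p hpp hpm
      by_contra hp2
      rcases hpp.dvd_mul.mp (hB p hpp hpm) with h | h
      · exact hp p hpp hp2 ((Nat.le_of_dvd hm hpm).trans hgt.le) h
      · exact hp2 (eq_two_of_prime_dvd_succ hu p hpp h))
    have e128 : 128 ^ (i + 1) = 2 ^ (7 * (i + 1)) := by rw [pow_mul]; norm_num
    rw [e128, ← pow_succ'] at hgt
    rw [e128] at hlt
    rw [hpow, Nat.pow_lt_pow_iff_right (by norm_num)] at hlt hgt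
    omega

end Mersenne

/-! ### Choice of the exponents `j` and of `k` -/

/-- For each `s` take the first `j` with `2 ^ s * (125/128) ^ j < 1`: minimality gives the lower
bound, and `128 ≤ 2 * 125` gives `j > s`. -/
theorem infinite_two_pow_mul_pow_near : {j : ℕ | j ≠ 0 ∧
    ∃ s, 2 ^ s * 125 ^ j < 128 ^ j ∧ 125 * 128 ^ j ≤ 128 * (2 ^ s * 125 ^ j)}.Infinite := by
  refine Set.infinite_of_forall_exists_gt fun s => ?_
  have hex : ∃ j, 2 ^ s * 125 ^ j < 128 ^ j := by
    obtain ⟨j, hj⟩ := exists_pow_lt_of_lt_one (show (0 : ℝ) < (1 / 2) ^ s by positivity)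
      (show (125 / 128 : ℝ) < 1 by norm_num)
    refine ⟨j, ?_⟩
    rw [div_pow, div_pow, one_pow, div_lt_div_iff₀ (by positivity) (by positivity)] at hj
    have : (2 ^ s * 125 ^ j : ℝ) < 128 ^ j := by linarith
    exact_mod_cast this
  classical
  obtain ⟨j, hj, hmin⟩ : ∃ j, 2 ^ s * 125 ^ j < 128 ^ j ∧
      ∀ j' < j, 128 ^ j' ≤ 2 ^ s * 125 ^ j' :=
    ⟨Nat.find hex, Nat.find_spec hex, fun j' h => not_lt.mp (Nat.find_min hex h)⟩
  have hsj : s < j := by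
    have h1 : 128 ^ j ≤ 2 ^ j * 125 ^ j := by
      rw [← mul_pow]; exact Nat.pow_le_pow_left (by norm_num) j
    exact (Nat.pow_lt_pow_iff_right (a := 2) (by norm_num)).mp
      (Nat.lt_of_mul_lt_mul_right (hj.trans_le h1))
  refine ⟨j, ⟨by omega, s, hj, ?_⟩, hsj⟩
  obtain ⟨i, rfl⟩ := Nat.exists_eq_succ_of_ne_zero (show j ≠ 0 by omega)
  have := hmin i (Nat.lt_succ_self i)
  rw [Nat.succ_eq_add_one, pow_succ, pow_succ]
  linarith

/-- By Euler, `2 ^ (φ(M) + 1) - 1 ≡ 1` modulo `M`, the product of 75 and the odd primes up to `N`.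
-/
theorem exists_mersenne_modEq_one (N : ℕ) : ∃ k u : ℕ, 3 ≤ k ∧ k + 1 = 2 ^ u ∧ k ≡ 1 [MOD 75] ∧
    ∀ p : ℕ, p.Prime → p ≠ 2 → p ≤ N → ¬ p ∣ k := by
  set M := 75 * ∏ p ∈ (Finset.range (N + 1)).filter fun p => p.Prime ∧ p ≠ 2, p with hM
  have hodd : Odd M := by
    refine Odd.mul (by decide) (Finset.prod_induction _ Odd (fun _ _ => Odd.mul) odd_one ?_)
    intro p hp
    obtain ⟨-, hp, h2⟩ := Finset.mem_filter.mp hp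
    exact hp.odd_of_ne_two h2
  have hphi : 0 < M.totient := Nat.totient_pos.mpr hodd.pos
  have hmod := Nat.ModEq.pow_totient (Nat.coprime_two_left.mpr hodd)
  have hpow : 2 ≤ 2 ^ M.totient := Nat.le_self_pow hphi.ne' 2
  have hk : 2 * 2 ^ M.totient - 1 ≡ 1 [MOD M] := by
    refine Nat.ModEq.add_right_cancel' 1 ?_
    rw [Nat.sub_add_cancel (by omega)]
    exact hmod.mul_left 2
  refine ⟨2 * 2 ^ M.totient - 1, M.totient + 1, by omega, by rw [pow_succ]; omega,
    hk.of_dvd (Dvd.intro _ rfl), fun p hp h2 hpN hdvd => hp.one_lt.ne' ?_⟩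
  have hpM : p ∣ M := (Finset.dvd_prod_of_mem (fun p => p) (Finset.mem_filter.mpr
    ⟨Finset.mem_range.mpr (by omega), hp, h2⟩)).mul_left 75
  exact Nat.dvd_one.mp (((hk.of_dvd hpM).dvd_iff dvd_rfl).mp hdvd)

/-! ### Conclusion -/

theorem exists_setF_finite_lt_ncard (B : ℕ) :
    ∃ k : ℕ, 1 < k ∧ (setF k).Finite ∧ B < (setF k).ncard := by
  obtain ⟨t, ht, hcard⟩ := infinite_two_pow_mul_pow_near.exists_subset_card_eq (B + 1)
  -- The sum is a crude common bound for all `2 * 128 ^ j` with `j ∈ t`. Distinct `j` will give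
  -- distinct values, the intervals being disjoint.
  obtain ⟨k, u, hk, hu, hmod, hp⟩ := exists_mersenne_modEq_one (∑ j ∈ t, 2 * 128 ^ j)
  have hfin : (setF k).Finite :=
    setF_finite hk (hmod.of_dvd (by norm_num : 3 ∣ 75)) hu
  have hmem : ∀ j ∈ t, ∃ m ∈ setF k, 128 ^ j < m ∧ m < 2 * 128 ^ j := by
    intro j hj
    obtain ⟨hj0, s, h1, h2⟩ := ht hj
    exact exists_mem_setF (hmod.of_dvd (by norm_num)) hu hj0 h1 h2 fun p hpp hp2 hpj =>
      hp p hpp hp2 (hpj.trans (Finset.single_le_sum (f := fun j => 2 * 128 ^ j)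
        (fun _ _ => Nat.zero_le _) hj))
  choose! f hf hlt hgt using hmem
  have hmono : ∀ i ∈ t, ∀ j ∈ t, i < j → f i < f j := by
    intro i hi j hj hij
    have h1 : 128 ^ (i + 1) ≤ 128 ^ j := Nat.pow_le_pow_right (by norm_num) hij
    have h2 := hgt i hi
    have h3 := hlt j hj
    rw [pow_succ] at h1
    omega
  have hinj : Set.InjOn f t := by
    intro i hi j hj hij
    by_contra hne
    rcases lt_or_gt_of_ne hne with h | h
    · exact (hmono i hi j hj h).ne hij
    · exact (hmono j hj i hi h).ne hij.symm
  refine ⟨k, by omega, hfin, ?_⟩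
  have hle : (t.image f).card ≤ (setF k).ncard := by
    rw [← Set.ncard_coe_finset]
    refine Set.ncard_le_ncard ?_ hfin
    intro m hm
    obtain ⟨j, hj, rfl⟩ := Finset.mem_image.mp (Finset.mem_coe.mp hm)
    exact hf j hj
  rw [Finset.card_image_of_injOn hinj, hcard] at hle
  omega

end LucasDiscriminator

theorem mainTheorem5 :
    {k : ℕ | 1 < k ∧ (LucasDiscriminator.setF k).Finite ∧
      (LucasDiscriminator.setF k).Nonempty}.Infinite ∧
    ∀ B : ℕ, ∃ k : ℕ, 1 < k ∧ (LucasDiscriminator.setF k).Finite ∧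
      B < (LucasDiscriminator.setF k).ncard := by
  refine ⟨fun hfin => ?_, LucasDiscriminator.exists_setF_finite_lt_ncard⟩
  -- Finitely many `k` would bound the cardinalities, against the second claim.
  obtain ⟨B, hB⟩ := (hfin.image fun k => (LucasDiscriminator.setF k).ncard).bddAbove
  obtain ⟨k, hk, hF, hlt⟩ := LucasDiscriminator.exists_setF_finite_lt_ncard B
  exact hlt.not_ge (hB ⟨k, ⟨hk, hF, Set.nonempty_of_ncard_ne_zero (by omega)⟩, rfl⟩)
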